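/- A poset $P$ is *ranked* if it has a strictly increasing rank function $\rho:P\to\mathbb{Z}_{\ge 0}$ that is $0$ on minimal elements and satisfies $\rho(y)=\rho(x)+1$ whenever $y$ covers $x$. A ranked poset is *upho* if every rank $P_k=\rho^{-1}(k)$ is finite and for every $s\in P$ the principal order filter $V_s=\{t\in P: t\ge s\}$ is isomorphic to $P$; its rank-generating function is $F_P(x)=\sum_{k\ge 0}|P_k|x^k$. It has up-degree $b$ if every element is covered by exactly $b$ elements. A *planar Hasse diagram* of $P$ places the elements of $P$ at distinct points of the plane, those of rank $i$ at height $y=i$, and draws each cover relation as a straight segment, in such a way that two different edges never meet except at a common endpoint; $P$ is *planar* if it has such a diagram. Given a planar Hasse diagram, a vertex $v$ is *root-bifurcated* if it covers exactly two vertices $v_1,v_2$, the meet of $v_1$ and $v_2$ is the least element $\hat 0$ of $P$, and no vertex of the same rank lies strictly between $v_1$ and $v_2$ in the diagram. **Theorem 1.3.** (1) Let $P$ be an infinite planar upho poset, with any fixed planar Hasse diagram. Then $P$ has an up-degree $b\in\mathbb{Z}_{\ge 0}$. If $a_i$ denotes the number of root-bifurcated vertices of rank $i$, then there is an $n$ with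 $a_i=0$ for all $i\notin\{2,\dots,n\}$, and with $$Q(x)=1-bx+a_2x^2+a_3x^3+\cdots+a_nx^n$$ we have $F_P(x)=Q(x)^{-1}$ in $\mathbb{Z}[[x]]$ and $Q(1)\le 0$. (2) Conversely, let $b,n,a_2,\dots,a_n\in\mathbb{Z}_{\ge 0}$ and let $Q(x)=1-bx+a_2x^2+\cdots+a_nx^n$ satisfy $Q(1)\le 0$. Then there is an infinite planar upho poset $P$ with up-degree $b$ and $F_P(x)=Q(x)^{-1}$. -/

import Mathlib

open Polynomial

/-- A ranked poset (its rank function is `grade ℕ`: strictly increasing, raised by exactly one along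
each cover relation, zero at minimal elements) is *upho* if every rank is finite and every principal
order filter is isomorphic to the whole poset. -/
def IsUpho (P : Type*) [PartialOrder P] [GradeMinOrder ℕ P] : Prop :=
  (∀ k : ℕ, {v : P | grade ℕ v = k}.Finite) ∧ ∀ s : P, Nonempty (Set.Ici s ≃o P)

/-- Every vertex is covered by exactly `b` vertices. -/
def HasUpDegree (P : Type*) [PartialOrder P] (b : ℕ) : Prop :=
  ∀ v : P, {w : P | v ⋖ w}.encard = b

/-- The rank-generating function `∑ₖ |Pₖ| xᵏ`. -/
noncomputable def rankGenFun (P : Type*) [PartialOrder P] [GradeMinOrder ℕ P] : PowerSeries ℤ :=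
  PowerSeries.mk fun k => ({v : P | grade ℕ v = k}.ncard : ℤ)

/-- A planar Hasse diagram: a vertex `v` of rank `i` is drawn at the point `(xpos v, i)`, distinct
vertices at distinct points, a cover relation is drawn as the line segment between its two ends, and
two different edges never meet except at a common end. (The ends of an edge lie on two consecutive
horizontal lines, so it suffices to ask that edges without their ends are disjoint.) -/
structure PlanarDiagram (P : Type*) [PartialOrder P] [GradeMinOrder ℕ P] where
  /-- the horizontal coordinate of a vertex -/
  xpos : P → ℝ
  point_injective : Function.Injective fun v : P => (xpos v, (grade ℕ v : ℝ))
  edges_disjoint : ∀ u v u' v' : P, u ⋖ v → u' ⋖ v' → (u, v) ≠ (u', v') →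
    Disjoint
      (openSegment ℝ (xpos u, (grade ℕ u : ℝ)) (xpos v, (grade ℕ v : ℝ)))
      (openSegment ℝ (xpos u', (grade ℕ u' : ℝ)) (xpos v', (grade ℕ v' : ℝ)))

/-- Two distinct vertices of the same rank are adjacent in the diagram if no vertex of that rank
lies strictly between them. -/
def PlanarDiagram.Adjacent {P : Type*} [PartialOrder P] [GradeMinOrder ℕ P] (D : PlanarDiagram P)
    (u v : P) : Prop :=
  u ≠ v ∧ grade ℕ u = grade ℕ v ∧
    ∀ w : P, grade ℕ w = grade ℕ u →
      ¬ (D.xpos u < D.xpos w ∧ D.xpos w < D.xpos v) ∧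
      ¬ (D.xpos v < D.xpos w ∧ D.xpos w < D.xpos u)

/-- `v` covers exactly two vertices, their meet is the least element of the poset, and they are
adjacent in the diagram. -/
def PlanarDiagram.RootBifurcated {P : Type*} [PartialOrder P] [GradeMinOrder ℕ P]
    (D : PlanarDiagram P) (v : P) : Prop :=
  ∃ v₁ v₂ : P, v₁ ≠ v₂ ∧ {w : P | w ⋖ v} = {v₁, v₂} ∧
    (∃ z : P, IsBot z ∧ IsGLB {v₁, v₂} z) ∧ D.Adjacent v₁ v₂

/-- The number of root-bifurcated vertices of rank `i`. -/
noncomputable def PlanarDiagram.rootBifurcatedCount {P : Type*} [PartialOrder P]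
    [GradeMinOrder ℕ P] (D : PlanarDiagram P) (i : ℕ) : ℕ :=
  {v : P | grade ℕ v = i ∧ D.RootBifurcated v}.ncard

/-- The polynomial `Q(x) = 1 - b x + a₂ x² + ⋯ + aₙ xⁿ`. -/
noncomputable def denomPoly (b n : ℕ) (a : ℕ → ℕ) : ℤ[X] :=
  1 - C (b : ℤ) * X + ∑ i ∈ Finset.Icc 2 n, C (a i : ℤ) * X ^ i

/-! Part (1) rests on one planarity principle, `exists_common_of_crossing`: two upward paths that
exchange their left-right order share a vertex. It yields meets of vertices of equal rank
(`exists_isGLB`), and, since the up-degree is constant, it shows that a vertex covers at most two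
others (`lowerCovers_eq_pair`). Count the edges between ranks `k` and `k + 1`: from below there are
`b` per vertex, from above one per vertex plus one more for each vertex with two lower covers. Sort
the latter by the meet `c` of their lower covers. By the isomorphism of `P` with the filter of `c`,
those over a given `c` of rank `j` number `a_{k+1-j}`. The resulting recurrence (`ncard_grade_succ`)
says `Q · F = 1` coefficientwise. For `Q(1) ≤ 0`, each root-bifurcated vertex is the join of two
consecutive atoms (`exists_atoms_isLUB`), and `b` atoms have only `b - 1` consecutive pairs.

Part (2) reverses this. Put `b = c + 1`; then `Q(1) ≤ 0` says that the `c` gaps between consecutive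
atoms suffice to let `a_{r+1}` of them close after `r` further rows. A single infinite word of gaps,
whose prefixes describe all rows, prescribes which neighbours share a child. The rows below any
vertex reproduce the prefixes of that word (`lst_iterate_eq_and_gap_eq`), whence the poset is upho;
counting the closing gaps gives the same recurrence (`rowCard_succ`). -/

section Graded

/-! ### Interpolation along ranks. -/

variable {P : Type*} [PartialOrder P] [GradeMinOrder ℕ P]

theorem grade_eq_add_one_of_covBy {u v : P} (h : u ⋖ v) : grade ℕ v = grade ℕ u + 1 :=
  (Nat.covBy_iff_add_one_eq.1 (h.grade ℕ)).symm

theorem exists_covBy_le {u t : P} (h : u < t) : ∃ w, u ⋖ w ∧ w ≤ t := by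
  have : WellFoundedLT P := GradeOrder.wellFoundedLT ℕ
  exact exists_covBy_le_of_lt h

theorem eq_of_le_of_grade_le {u t : P} (h : u ≤ t) (hg : grade ℕ t ≤ grade ℕ u) : u = t := by
  by_contra hne
  exact absurd (grade_strictMono (𝕆 := ℕ) (lt_of_le_of_ne h hne)) (not_lt.2 hg)

theorem covBy_of_le_of_grade {u t : P} (h : u ≤ t) (hg : grade ℕ t = grade ℕ u + 1) : u ⋖ t := by
  have hlt : u < t := lt_of_le_of_ne h (by rintro rfl; omega)
  obtain ⟨w, hw, hwt⟩ := exists_covBy_le hlt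
  rwa [← eq_of_le_of_grade_le hwt (by rw [grade_eq_add_one_of_covBy hw, hg])]

theorem exists_between_of_grade {t : P} {r : ℕ} :
    ∀ {u : P}, u ≤ t → grade ℕ u ≤ r → r ≤ grade ℕ t → ∃ m, u ≤ m ∧ m ≤ t ∧ grade ℕ m = r := by
  suffices H : ∀ k : ℕ, ∀ u : P, grade ℕ u + k = r → u ≤ t → r ≤ grade ℕ t →
      ∃ m, u ≤ m ∧ m ≤ t ∧ grade ℕ m = r by
    intro u hut hur hrt
    exact H (r - grade ℕ u) u (by omega) hut hrt
  intro k
  induction k with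
  | zero => intro u hk hut _; exact ⟨u, le_rfl, hut, hk⟩
  | succ k ih =>
    intro u hk hut hrt
    have hlt : u < t := lt_of_le_of_ne hut (by rintro rfl; omega)
    obtain ⟨w, hw, hwt⟩ := exists_covBy_le hlt
    obtain ⟨m, h1, h2, h3⟩ := ih w (by rw [grade_eq_add_one_of_covBy hw]; omega) hwt hrt
    exact ⟨m, hw.le.trans h1, h2, h3⟩

theorem exists_le_of_grade [NoMaxOrder P] (u : P) {r : ℕ} (h : grade ℕ u ≤ r) :
    ∃ t, u ≤ t ∧ grade ℕ t = r := by
  induction r, h using Nat.le_induction with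
  | base => exact ⟨u, le_rfl, rfl⟩
  | succ r _ ih =>
    obtain ⟨t, hut, ht⟩ := ih
    obtain ⟨s, hs⟩ := exists_gt t
    obtain ⟨w, hw, -⟩ := exists_covBy_le hs
    exact ⟨w, hut.trans hw.le, by rw [grade_eq_add_one_of_covBy hw, ht]⟩

/-! ### Crossing paths and meets in a planar diagram. -/

namespace PlanarDiagram

variable (D : PlanarDiagram P)

theorem eq_of_xpos {u v : P} (hg : grade ℕ u = grade ℕ v) (hx : D.xpos u = D.xpos v) : u = v :=
  D.point_injective (by simp [hg, hx])

theorem xpos_le_of_covBy {u v u' v' : P} (hg : grade ℕ u = grade ℕ u')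
    (hx : D.xpos u < D.xpos u') (h : u ⋖ v) (h' : u' ⋖ v') : D.xpos v ≤ D.xpos v' := by
  by_contra! hlt
  have hne : (u, v) ≠ (u', v') := by
    rintro ⟨⟩
    exact lt_irrefl _ hx
  have hdis := D.edges_disjoint u v u' v' h h' hne
  have hgv : grade ℕ v = grade ℕ v' := by
    rw [grade_eq_add_one_of_covBy h, grade_eq_add_one_of_covBy h', hg]
  set d := D.xpos u' - D.xpos u with hd
  set e := D.xpos v - D.xpos v' with he
  have hd0 : 0 < d := sub_pos.2 hx
  have he0 : 0 < e := sub_pos.2 hlt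
  -- The horizontal offset of the two segments runs linearly from `d` to `-e`, so it vanishes at
  -- this parameter.
  have hθ : d / (d + e) ∈ Set.Ioo (0 : ℝ) 1 :=
    ⟨by positivity, by rw [div_lt_one (by positivity)]; linarith⟩
  rw [openSegment_eq_image, openSegment_eq_image, Set.disjoint_left] at hdis
  refine hdis ⟨_, hθ, rfl⟩ ⟨_, hθ, ?_⟩
  rw [hg, hgv]
  ext
  · simp only [Prod.smul_mk, smul_eq_mul, Prod.mk_add_mk]
    field_simp
    rw [hd, he]
    ring
  · rfl

/-- Two upward paths that exchange their horizontal order share a vertex. -/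
theorem exists_common_of_crossing {u u' t t' : P} (hg : grade ℕ u = grade ℕ u')
    (hg' : grade ℕ t = grade ℕ t') (hut : u ≤ t) (hut' : u' ≤ t')
    (hx : D.xpos u ≤ D.xpos u') (hx' : D.xpos t' ≤ D.xpos t) :
    ∃ w, u ≤ w ∧ u' ≤ w ∧ w ≤ t ∧ w ≤ t' := by
  suffices H : ∀ k : ℕ, ∀ u u' : P, grade ℕ u + k = grade ℕ t → grade ℕ u = grade ℕ u' → u ≤ t →
      u' ≤ t' → D.xpos u ≤ D.xpos u' → ∃ w, u ≤ w ∧ u' ≤ w ∧ w ≤ t ∧ w ≤ t' from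
    H (grade ℕ t - grade ℕ u) u u'
      (Nat.add_sub_cancel' ((grade_strictMono (𝕆 := ℕ)).monotone hut)) hg hut hut' hx
  intro k
  induction k with
  | zero =>
    intro u u' hk hg hut hut' hx
    obtain rfl := eq_of_le_of_grade_le hut (by omega)
    obtain rfl := eq_of_le_of_grade_le hut' (by omega)
    obtain rfl := D.eq_of_xpos hg (le_antisymm hx hx')
    exact ⟨u, le_rfl, le_rfl, le_rfl, le_rfl⟩
  | succ k ih =>
    intro u u' hk hg hut hut' hx
    rcases hx.eq_or_lt with hx | hx
    · obtain rfl := D.eq_of_xpos hg hx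
      exact ⟨u, le_rfl, le_rfl, hut, hut'⟩
    · have hlt : u < t := lt_of_le_of_ne hut (by rintro rfl; omega)
      have hlt' : u' < t' := lt_of_le_of_ne hut' (by rintro rfl; omega)
      obtain ⟨w, hw, hwt⟩ := exists_covBy_le hlt
      obtain ⟨w', hw', hwt'⟩ := exists_covBy_le hlt'
      obtain ⟨m, h1, h2, h3, h4⟩ := ih w w' (by rw [grade_eq_add_one_of_covBy hw]; omega)
        (by rw [grade_eq_add_one_of_covBy hw, grade_eq_add_one_of_covBy hw', hg]) hwt hwt'
        (D.xpos_le_of_covBy hg hx hw hw')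
      exact ⟨m, hw.le.trans h1, hw'.le.trans h2, h3, h4⟩

/-- A path going up from `m` is trapped between paths from `u` and `u'` to `w`: it must meet one of
them by the rank of `w`. -/
theorem le_of_xpos_between [NoMaxOrder P] {u m u' w : P} (hg : grade ℕ u = grade ℕ m)
    (hg' : grade ℕ m = grade ℕ u') (hx : D.xpos u ≤ D.xpos m) (hx' : D.xpos m ≤ D.xpos u')
    (hu : u ≤ w) (hu' : u' ≤ w) : m ≤ w := by
  obtain ⟨t, hmt, ht⟩ := exists_le_of_grade (r := grade ℕ w) m
    (hg ▸ (grade_strictMono (𝕆 := ℕ)).monotone hu)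
  rcases le_total (D.xpos t) (D.xpos w) with h | h
  · obtain ⟨s, -, h1, h2, -⟩ := D.exists_common_of_crossing hg ht.symm hu hmt hx h
    exact h1.trans h2
  · obtain ⟨s, h1, -, -, h2⟩ := D.exists_common_of_crossing hg' ht hmt hu' hx' h
    exact h1.trans h2

/-- A common lower bound `c` of maximal rank is the meet. For another one, `d`, paths from `d` to
`v₁` and `v₂` enclose `c`, so a path from the bottom to `c` must meet one of them at or above `d`.
-/
theorem exists_isGLB (D : PlanarDiagram P) {z : P} (hz : IsBot z) {v₁ v₂ : P}
    (hg : grade ℕ v₁ = grade ℕ v₂) :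
    ∃ c, IsGLB {v₁, v₂} c := by
  wlog hx : D.xpos v₁ ≤ D.xpos v₂ generalizing v₁ v₂
  · rw [Set.pair_comm]
    exact this hg.symm (le_of_not_ge hx)
  have hmono := (grade_strictMono (𝕆 := ℕ) (α := P)).monotone
  have hmax : ∃ c, (c ≤ v₁ ∧ c ≤ v₂) ∧ ∀ d, d ≤ v₁ ∧ d ≤ v₂ → grade ℕ d ≤ grade ℕ c := by
    have hfin : (grade ℕ '' {c | c ≤ v₁ ∧ c ≤ v₂}).Finite :=
      (Set.finite_Iic (grade ℕ v₁)).subset (by rintro _ ⟨c, hc, rfl⟩; exact hmono hc.1)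
    obtain ⟨_, ⟨c, hc, rfl⟩, hcm⟩ :=
      Set.exists_max_image _ id hfin ⟨_, z, ⟨hz v₁, hz v₂⟩, rfl⟩
    exact ⟨c, hc, fun d hd => hcm _ ⟨d, hd, rfl⟩⟩
  obtain ⟨c, ⟨hc1, hc2⟩, hcm⟩ := hmax
  have hceq : ∀ w, c ≤ w → w ≤ v₁ → w ≤ v₂ → w = c := fun w h h1 h2 =>
    (eq_of_le_of_grade_le h (hcm w ⟨h1, h2⟩)).symm
  refine ⟨c, ?_, ?_⟩
  · simp [lowerBounds, hc1, hc2]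
  intro d hd
  have hd1 : d ≤ v₁ := hd (by simp)
  have hd2 : d ≤ v₂ := hd (by simp)
  obtain ⟨p₁, hdp₁, hp₁, hgp₁⟩ := exists_between_of_grade hd1 (hcm d ⟨hd1, hd2⟩) (hmono hc1)
  obtain ⟨p₂, hdp₂, hp₂, hgp₂⟩ := exists_between_of_grade hd2 (hcm d ⟨hd1, hd2⟩) (hmono hc2)
  -- If `p₁` were to the right of `c`, the paths `p₁` to `v₁` and `c` to `v₂` would cross in a
  -- common lower bound above both, which is `c` by maximality; then `p₁ = c`.
  have hpc₁ : D.xpos p₁ ≤ D.xpos c := by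
    by_contra! h
    obtain ⟨w, h1, h2, h3, h4⟩ :=
      D.exists_common_of_crossing hgp₁.symm hg.symm hc2 hp₁ h.le hx
    obtain rfl := hceq w h1 h4 h3
    exact h.ne' (by rw [eq_of_le_of_grade_le h2 hgp₁.ge])
  have hpc₂ : D.xpos c ≤ D.xpos p₂ := by
    by_contra! h
    obtain ⟨w, h1, h2, h3, h4⟩ :=
      D.exists_common_of_crossing hgp₂ hg.symm hp₂ hc1 h.le hx
    obtain rfl := hceq w h2 h4 h3
    exact h.ne (by rw [eq_of_le_of_grade_le h1 hgp₂.ge])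
  obtain ⟨q, -, hqc, hgq⟩ := exists_between_of_grade (hz c)
    (hmono (hz d)) (hcm d ⟨hd1, hd2⟩)
  rcases le_total (D.xpos q) (D.xpos d) with h | h
  · obtain ⟨w, -, h2, h3, -⟩ := D.exists_common_of_crossing hgq hgp₁.symm hqc hdp₁ h hpc₁
    exact h2.trans h3
  · obtain ⟨w, h1, -, -, h4⟩ := D.exists_common_of_crossing hgq.symm hgp₂ hdp₂ hqc h hpc₂
    exact h1.trans h4

end PlanarDiagram

end Graded

/-! ### Self-embeddings of an upho poset onto its principal filters. -/

theorem embedding_covBy_iff {P : Type*} [PartialOrder P] {f : P ↪o P} {v : P}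
    (hf : Set.range f = Set.Ici v) {a b : P} : f a ⋖ f b ↔ a ⋖ b :=
  Set.OrdConnected.apply_covBy_apply_iff f (hf ▸ Set.ordConnected_Ici)

theorem embedding_bot {P : Type*} [PartialOrder P] {f : P ↪o P} {v z : P}
    (hf : Set.range f = Set.Ici v) (hz : IsBot z) : f z = v := by
  obtain ⟨y, rfl⟩ : v ∈ Set.range f := hf ▸ Set.self_mem_Ici
  exact le_antisymm (f.le_iff_le.2 (hz y)) (hf ▸ Set.mem_range_self z : f z ∈ Set.Ici (f y))

section Upho

variable {P : Type*} [PartialOrder P] [GradeMinOrder ℕ P]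

theorem grade_bot_eq_zero {z : P} (hz : IsBot z) : grade ℕ z = 0 :=
  Nat.le_zero.1 ((hz.isMin.grade ℕ) (Nat.zero_le _))

theorem eq_bot_of_grade_eq_zero {z v : P} (hz : IsBot z) (hv : grade ℕ v = 0) : v = z :=
  (eq_of_le_of_grade_le (hz v) (by omega)).symm

theorem exists_covBy_of_grade {z v : P} (hz : IsBot z) {k : ℕ} (hv : grade ℕ v = k + 1) :
    ∃ u, u ⋖ v ∧ grade ℕ u = k := by
  obtain ⟨u, -, huv, hu⟩ := exists_between_of_grade (hz v) (r := k)
    (by rw [grade_bot_eq_zero hz]; omega) (by omega)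
  exact ⟨u, covBy_of_le_of_grade huv (by omega), hu⟩

theorem IsUpho.exists_embedding (h : IsUpho P) (v : P) :
    ∃ f : P ↪o P, Set.range f = Set.Ici v := by
  obtain ⟨e⟩ := h.2 v
  refine ⟨e.symm.toOrderEmbedding.trans (OrderEmbedding.subtype _), ?_⟩
  ext w
  constructor
  · rintro ⟨y, rfl⟩
    exact (e.symm y).2
  · intro hw
    exact ⟨e ⟨w, hw⟩, by simp⟩

theorem IsUpho.exists_isBot [Nonempty P] (h : IsUpho P) : ∃ z : P, IsBot z := by
  obtain ⟨v⟩ := ‹Nonempty P›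
  obtain ⟨f, hf⟩ := h.exists_embedding v
  obtain ⟨z, hz⟩ : v ∈ Set.range f := hf ▸ Set.self_mem_Ici
  refine ⟨z, fun w => f.le_iff_le.1 ?_⟩
  rw [hz]
  exact (hf ▸ Set.mem_range_self w : f w ∈ Set.Ici v)

theorem IsUpho.noMaxOrder [Infinite P] (h : IsUpho P) : NoMaxOrder P := by
  refine ⟨fun v => ?_⟩
  by_contra! hv
  obtain ⟨f, hf⟩ := h.exists_embedding v
  refine not_injective_infinite_finite (fun w => (⟨f w, ?_⟩ : ({v} : Set P)))
    fun a b hab => f.injective (by simpa using hab)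
  have hw : v ≤ f w := (hf ▸ Set.mem_range_self w : f w ∈ Set.Ici v)
  exact ((lt_or_eq_of_le hw).resolve_left (hv _)).symm

section Embedding

variable {f : P ↪o P} {v z : P}

theorem grade_embedding (hf : Set.range f = Set.Ici v) (hz : IsBot z) (w : P) :
    grade ℕ (f w) = grade ℕ v + grade ℕ w := by
  obtain ⟨k, hk⟩ : ∃ k, grade ℕ w = k := ⟨_, rfl⟩
  induction k generalizing w with
  | zero =>
    rw [eq_bot_of_grade_eq_zero hz hk, embedding_bot hf hz, grade_bot_eq_zero hz, add_zero]
  | succ k ih =>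
    obtain ⟨u, huw, hu⟩ := exists_covBy_of_grade hz hk
    rw [grade_eq_add_one_of_covBy ((embedding_covBy_iff hf).2 huw), ih u hu, hk, hu, add_assoc]

end Embedding

theorem IsUpho.hasUpDegree (h : IsUpho P) {z : P} (hz : IsBot z) :
    HasUpDegree P {w : P | z ⋖ w}.ncard := by
  intro v
  obtain ⟨f, hf⟩ := h.exists_embedding v
  have hfin : {w : P | z ⋖ w}.Finite := (h.1 1).subset fun w hw => by
    rw [Set.mem_ofPred_eq, grade_eq_add_one_of_covBy hw, grade_bot_eq_zero hz]
  have himage : {w : P | v ⋖ w} = f '' {w | z ⋖ w} := by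
    ext w
    constructor
    · intro hw
      obtain ⟨y, rfl⟩ : w ∈ Set.range f := hf ▸ (show v ⋖ w from hw).le
      refine ⟨y, ?_, rfl⟩
      rwa [Set.mem_ofPred_eq, ← embedding_bot hf hz, embedding_covBy_iff hf] at hw
    · rintro ⟨y, hy, rfl⟩
      rw [Set.mem_ofPred_eq, ← embedding_bot hf hz, embedding_covBy_iff hf]
      exact hy
  rw [himage, f.injective.encard_image, hfin.cast_ncard_eq]

/-- Up-degree one makes `P` a chain, the degenerate case to be excluded in `not_covBy_of_between`.
-/
theorem eq_of_grade_of_upDegree_one {z : P} (hz : IsBot z) (hb : HasUpDegree P 1) {k : ℕ} :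
    ∀ {u v : P}, grade ℕ u = k → grade ℕ v = k → u = v := by
  induction k with
  | zero =>
    intro u v hu hv
    rw [eq_bot_of_grade_eq_zero hz hu, eq_bot_of_grade_eq_zero hz hv]
  | succ k ih =>
    intro u v hu hv
    obtain ⟨u', hu', hgu⟩ := exists_covBy_of_grade hz hu
    obtain ⟨v', hv', hgv⟩ := exists_covBy_of_grade hz hv
    obtain rfl := ih hgu hgv
    obtain ⟨w, hw⟩ := Set.encard_eq_one.1 (hb u')
    have h1 : u ∈ {w : P | u' ⋖ w} := hu'
    have h2 : v ∈ {w : P | u' ⋖ w} := hv'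
    rw [hw] at h1 h2
    exact h1.trans h2.symm

/-! ### Vertices with two lower covers and the rank recurrence. -/

/-- `v` covers two distinct elements whose meet is `c`. -/
def BifurcatedAt (c v : P) : Prop :=
  ∃ v₁ v₂ : P, v₁ ≠ v₂ ∧ v₁ ⋖ v ∧ v₂ ⋖ v ∧ IsGLB {v₁, v₂} c

namespace PlanarDiagram

variable (D : PlanarDiagram P)

/-- Every cover of `w₂` is squeezed onto `v` by the edges from `w₁` and `w₃`, so the up-degree is
one and each rank is a single vertex. -/
theorem not_covBy_of_between {z : P} (hz : IsBot z) {b : ℕ} (hb : HasUpDegree P b) [NoMaxOrder P]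
    {w₁ w₂ w₃ v : P} (h₁ : w₁ ⋖ v) (hg : grade ℕ w₂ = grade ℕ w₁)
    (h₁₂ : D.xpos w₁ < D.xpos w₂) (h₂₃ : D.xpos w₂ < D.xpos w₃) : ¬ w₃ ⋖ v := by
  intro h₃
  have hgv := grade_eq_add_one_of_covBy h₁
  have hg₃ := grade_eq_add_one_of_covBy h₃
  have hcov : ∀ t, w₂ ⋖ t → t = v := fun t ht =>
    D.eq_of_xpos (by rw [grade_eq_add_one_of_covBy ht]; omega)
      (le_antisymm (D.xpos_le_of_covBy (by omega) h₂₃ ht h₃)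
        (D.xpos_le_of_covBy hg.symm h₁₂ h₁ ht))
  obtain ⟨s, hs⟩ := exists_gt w₂
  obtain ⟨t, ht, -⟩ := exists_covBy_le hs
  have hset : {t : P | w₂ ⋖ t} = {v} := Set.eq_singleton_iff_unique_mem.2 ⟨hcov t ht ▸ ht, hcov⟩
  have hb1 : b = 1 := by
    have := hb w₂
    rw [hset, Set.encard_singleton] at this
    exact_mod_cast this.symm
  subst hb1
  exact h₁₂.ne (by rw [eq_of_grade_of_upDegree_one hz hb hg rfl])

theorem adjacent_of_covBy {z : P} (hz : IsBot z) {b : ℕ} (hb : HasUpDegree P b) [NoMaxOrder P]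
    {v₁ v₂ v : P} (hne : v₁ ≠ v₂) (h₁ : v₁ ⋖ v) (h₂ : v₂ ⋖ v) : D.Adjacent v₁ v₂ := by
  have hg : grade ℕ v₁ = grade ℕ v₂ := by
    have := grade_eq_add_one_of_covBy h₁
    have := grade_eq_add_one_of_covBy h₂
    omega
  refine ⟨hne, hg, fun w hw => ⟨fun h => ?_, fun h => ?_⟩⟩
  · exact D.not_covBy_of_between hz hb h₁ hw h.1 h.2 h₂
  · exact D.not_covBy_of_between hz hb h₂ (hw.trans hg) h.1 h.2 h₁

theorem lowerCovers_eq_pair (D : PlanarDiagram P) {z : P} (hz : IsBot z) {b : ℕ}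
    (hb : HasUpDegree P b) [NoMaxOrder P]
    {v₁ v₂ v : P} (hne : v₁ ≠ v₂) (h₁ : v₁ ⋖ v) (h₂ : v₂ ⋖ v) : {w : P | w ⋖ v} = {v₁, v₂} := by
  ext w
  simp only [Set.mem_ofPred_eq, Set.mem_insert_iff, Set.mem_singleton_iff]
  refine ⟨fun hw => ?_, by rintro (rfl | rfl) <;> assumption⟩
  by_contra! hcon
  have g₁ := grade_eq_add_one_of_covBy h₁
  have g₂ := grade_eq_add_one_of_covBy h₂
  have g := grade_eq_add_one_of_covBy hw
  have hA := (D.adjacent_of_covBy hz hb hne h₁ h₂).2.2 w (by omega)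
  have hB := (D.adjacent_of_covBy hz hb hcon.1 hw h₁).2.2 v₂ (by omega)
  have hC := (D.adjacent_of_covBy hz hb hcon.2 hw h₂).2.2 v₁ (by omega)
  have n₁ : D.xpos w ≠ D.xpos v₁ := fun h => hcon.1 (D.eq_of_xpos (by omega) h)
  have n₂ : D.xpos w ≠ D.xpos v₂ := fun h => hcon.2 (D.eq_of_xpos (by omega) h)
  have n₃ : D.xpos v₁ ≠ D.xpos v₂ := fun h => hne (D.eq_of_xpos (by omega) h)
  grind

/-- Adjacency and the absence of a third lower cover are automatic, so only an order-theoretic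
condition remains, which embeddings can transport. -/
theorem rootBifurcated_iff {z : P} (hz : IsBot z) {b : ℕ} (hb : HasUpDegree P b) [NoMaxOrder P]
    {v : P} : D.RootBifurcated v ↔ BifurcatedAt z v := by
  constructor
  · rintro ⟨v₁, v₂, hne, hset, ⟨z', hz', hglb⟩, -⟩
    obtain rfl : z' = z := le_antisymm (hz' _) (hz _)
    refine ⟨v₁, v₂, hne, ?_, ?_, hglb⟩
    · have : v₁ ∈ {w : P | w ⋖ v} := by simp [hset]
      exact this
    · have : v₂ ∈ {w : P | w ⋖ v} := by simp [hset]
      exact this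
  · rintro ⟨v₁, v₂, hne, h₁, h₂, hglb⟩
    exact ⟨v₁, v₂, hne, D.lowerCovers_eq_pair hz hb hne h₁ h₂, ⟨z, hz, hglb⟩,
      D.adjacent_of_covBy hz hb hne h₁ h₂⟩

theorem bifurcatedAt_embedding_iff (D : PlanarDiagram P) {z c : P} (hz : IsBot z) {f : P ↪o P}
    (hf : Set.range f = Set.Ici c) {v : P} : BifurcatedAt c (f v) ↔ BifurcatedAt z v := by
  have hfz := embedding_bot hf hz
  have hmem : ∀ {y}, c ≤ y → ∃ x, f x = y := fun {y} hy => (hf ▸ hy : y ∈ Set.range f)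
  have hle : ∀ x, c ≤ f x := fun x => (hf ▸ Set.mem_range_self x : f x ∈ Set.Ici c)
  constructor
  · rintro ⟨t₁, t₂, hne, h₁, h₂, hglb⟩
    obtain ⟨v₁, rfl⟩ := hmem (hglb.1 (by simp : t₁ ∈ _))
    obtain ⟨v₂, rfl⟩ := hmem (hglb.1 (by simp : t₂ ∈ _))
    rw [embedding_covBy_iff hf] at h₁ h₂
    refine ⟨v₁, v₂, fun h => hne (h ▸ rfl), h₁, h₂, by simp [lowerBounds, hz _], fun d hd => ?_⟩
    rw [← f.le_iff_le, hfz]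
    refine hglb.2 ?_
    rintro _ (rfl | rfl)
    · exact f.le_iff_le.2 (hd (by simp))
    · exact f.le_iff_le.2 (hd (by simp))
  · rintro ⟨v₁, v₂, hne, h₁, h₂, hglb⟩
    have hg : grade ℕ (f v₁) = grade ℕ (f v₂) := by
      have := grade_eq_add_one_of_covBy h₁
      have := grade_eq_add_one_of_covBy h₂
      rw [grade_embedding hf hz, grade_embedding hf hz]
      omega
    -- Transport gives a meet only inside the filter of `c`. A meet `m` in all of `P` exists by
    -- planarity; it lies above `c`, hence in the filter, hence equals `c`.
    obtain ⟨m, hm⟩ := D.exists_isGLB hz hg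
    have hcm : c ≤ m := hm.2 (by simp [lowerBounds, hle])
    have hmc : m = c := by
      obtain ⟨x, rfl⟩ := hmem hcm
      refine le_antisymm ?_ hcm
      rw [← hfz, f.le_iff_le]
      refine hglb.2 ?_
      rintro _ (rfl | rfl)
      · exact f.le_iff_le.1 (hm.1 (by simp))
      · exact f.le_iff_le.1 (hm.1 (by simp))
    exact ⟨f v₁, f v₂, f.injective.ne hne, (embedding_covBy_iff hf).2 h₁,
      (embedding_covBy_iff hf).2 h₂, hmc ▸ hm⟩

/-- The number of vertices of rank `k + 1` covering two elements with meet `c`. -/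
theorem ncard_bifurcatedAt (h : IsUpho P) {z : P} (hz : IsBot z) {b : ℕ} (hb : HasUpDegree P b)
    [NoMaxOrder P] (c : P) (k : ℕ) :
    {v : P | grade ℕ v = grade ℕ c + k ∧ BifurcatedAt c v}.ncard = D.rootBifurcatedCount k := by
  obtain ⟨f, hf⟩ := h.exists_embedding c
  have himage : {v : P | grade ℕ v = grade ℕ c + k ∧ BifurcatedAt c v} =
      f '' {v : P | grade ℕ v = k ∧ D.RootBifurcated v} := by
    ext w
    constructor
    · rintro ⟨hw, hB⟩
      have hcw : c ≤ w := by
        obtain ⟨v₁, _, -, h₁, -, hglb⟩ := hB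
        exact (hglb.1 (by simp : v₁ ∈ _)).trans h₁.le
      obtain ⟨y, rfl⟩ : w ∈ Set.range f := hf ▸ hcw
      rw [grade_embedding hf hz] at hw
      exact ⟨y, ⟨by omega, (D.rootBifurcated_iff hz hb).2
        ((D.bifurcatedAt_embedding_iff hz hf).1 hB)⟩, rfl⟩
    · rintro ⟨y, ⟨hy, hR⟩, rfl⟩
      exact ⟨by rw [grade_embedding hf hz, hy], (D.bifurcatedAt_embedding_iff hz hf).2
        ((D.rootBifurcated_iff hz hb).1 hR)⟩
  rw [himage, Set.ncard_image_of_injective _ f.injective, rootBifurcatedCount]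

theorem bifurcatedAt_unique (D : PlanarDiagram P) {z : P} (hz : IsBot z) {b : ℕ} (hb : HasUpDegree P b)
    [NoMaxOrder P] {c c' v : P} (h : BifurcatedAt c v) (h' : BifurcatedAt c' v) : c = c' := by
  obtain ⟨v₁, v₂, hne, h₁, h₂, hglb⟩ := h
  obtain ⟨w₁, w₂, hne', h₁', h₂', hglb'⟩ := h'
  have e := D.lowerCovers_eq_pair hz hb hne h₁ h₂
  rw [D.lowerCovers_eq_pair hz hb hne' h₁' h₂'] at e
  rw [e] at hglb'
  exact hglb.unique hglb'

theorem rootBifurcatedCount_zero {z : P} (hz : IsBot z) {b : ℕ} (hb : HasUpDegree P b)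
    [NoMaxOrder P] : D.rootBifurcatedCount 0 = 0 := by
  have : {v : P | grade ℕ v = 0 ∧ D.RootBifurcated v} = ∅ := by
    ext v
    simp only [Set.mem_ofPred_eq, Set.mem_empty_iff_false, iff_false, not_and]
    intro hv hR
    obtain ⟨v₁, v₂, -, h₁, -⟩ := (D.rootBifurcated_iff hz hb).1 hR
    have := grade_eq_add_one_of_covBy h₁
    omega
  rw [rootBifurcatedCount, this, Set.ncard_empty]

theorem rootBifurcatedCount_one {z : P} (hz : IsBot z) {b : ℕ} (hb : HasUpDegree P b)
    [NoMaxOrder P] : D.rootBifurcatedCount 1 = 0 := by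
  have : {v : P | grade ℕ v = 1 ∧ D.RootBifurcated v} = ∅ := by
    ext v
    simp only [Set.mem_ofPred_eq, Set.mem_empty_iff_false, iff_false, not_and]
    intro hv hR
    obtain ⟨v₁, v₂, hne, h₁, h₂, -⟩ := (D.rootBifurcated_iff hz hb).1 hR
    have := grade_eq_add_one_of_covBy h₁
    have := grade_eq_add_one_of_covBy h₂
    exact hne ((eq_bot_of_grade_eq_zero hz (by omega)).trans
      (eq_bot_of_grade_eq_zero hz (by omega)).symm)
  rw [rootBifurcatedCount, this, Set.ncard_empty]

open Classical in
-- Double counting of the cover relations between ranks `k` and `k + 1`. The sum counts the vertices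
-- of rank `k + 1` with two lower covers, sorted by the meet `c` of these: `ij.2` is the rank of
-- `c`, and `ij.1` the height above it.
theorem ncard_grade_succ (h : IsUpho P) {z : P} (hz : IsBot z) {b : ℕ} (hb : HasUpDegree P b)
    [NoMaxOrder P] (k : ℕ) :
    {v : P | grade ℕ v = k + 1}.ncard + ∑ ij ∈ Finset.HasAntidiagonal.antidiagonal (k + 1),
      D.rootBifurcatedCount ij.1 * {v : P | grade ℕ v = ij.2}.ncard =
    b * {v : P | grade ℕ v = k}.ncard := by
  set R : ℕ → Finset P := fun k => (h.1 k).toFinset with hR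
  have hmem : ∀ {k v}, v ∈ R k ↔ grade ℕ v = k := by simp [hR]
  have hcard : ∀ k, {v : P | grade ℕ v = k}.ncard = (R k).card := fun k =>
    Set.ncard_eq_toFinset_card _ (h.1 k)
  simp only [hcard]
  have hdouble := Finset.sum_card_bipartiteAbove_eq_sum_card_bipartiteBelow
    (fun u v : P => u ⋖ v) (s := R k) (t := R (k + 1))
  have hup : ∀ u ∈ R k, (Finset.bipartiteAbove (fun u v : P => u ⋖ v) (R (k + 1)) u).card = b := by
    intro u hu
    have := hb u
    have hset : {w : P | u ⋖ w} =
        ↑(Finset.bipartiteAbove (fun u v : P => u ⋖ v) (R (k + 1)) u) := by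
      ext w
      simp only [Set.mem_ofPred_eq, Finset.mem_coe, Finset.mem_bipartiteAbove, iff_and_self]
      intro hw
      rw [hmem, grade_eq_add_one_of_covBy hw, hmem.1 hu]
    rw [hset, Set.encard_coe_eq_coe_finsetCard] at this
    exact_mod_cast this
  rw [Finset.sum_congr rfl hup, Finset.sum_const, smul_eq_mul] at hdouble
  have hdown : ∀ v ∈ R (k + 1),
      (Finset.bipartiteBelow (fun u v : P => u ⋖ v) (R k) v).card =
        1 + if ∃ c, BifurcatedAt c v then 1 else 0 := by
    intro v hv
    obtain ⟨u, huv, hu⟩ := exists_covBy_of_grade hz (hmem.1 hv)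
    have hbelow : ∀ w, w ∈ Finset.bipartiteBelow (fun u v : P => u ⋖ v) (R k) v ↔ w ⋖ v := by
      intro w
      rw [Finset.mem_bipartiteBelow, and_iff_right_iff_imp, hmem]
      intro hw
      have := grade_eq_add_one_of_covBy hw
      have := hmem.1 hv
      omega
    split_ifs with hB
    · obtain ⟨c, v₁, v₂, hne, h₁, h₂, -⟩ := hB
      have := D.lowerCovers_eq_pair hz hb hne h₁ h₂
      rw [Finset.card_eq_two]
      refine ⟨v₁, v₂, hne, ?_⟩
      ext w
      rw [hbelow]
      simpa using Set.ext_iff.1 this w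
    · rw [Finset.card_eq_one]
      refine ⟨u, ?_⟩
      ext w
      rw [hbelow, Finset.mem_singleton]
      refine ⟨fun hw => ?_, fun hw => hw ▸ huv⟩
      by_contra hne
      have hg : grade ℕ w = grade ℕ u := by
        have := grade_eq_add_one_of_covBy hw
        have := grade_eq_add_one_of_covBy huv
        omega
      obtain ⟨c, hc⟩ := D.exists_isGLB hz hg
      exact hB ⟨c, w, u, hne, hw, huv, hc⟩
  rw [Finset.sum_congr rfl hdown, Finset.sum_add_distrib, Finset.sum_const, smul_eq_mul,
    mul_one, ← Finset.card_filter] at hdouble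
  rw [mul_comm b, hdouble, Nat.add_left_cancel_iff]
  have hunion : (R (k + 1)).filter (fun v => ∃ c, BifurcatedAt c v) =
      (Finset.HasAntidiagonal.antidiagonal (k + 1)).biUnion fun ij => (R ij.2).biUnion fun c =>
        (R (k + 1)).filter fun v => BifurcatedAt c v := by
    ext v
    simp only [Finset.mem_filter, Finset.mem_biUnion, Finset.HasAntidiagonal.mem_antidiagonal, hmem]
    constructor
    · rintro ⟨hv, c, hc⟩
      have hcv : c ≤ v := by
        obtain ⟨v₁, _, -, h₁, -, hglb⟩ := hc
        exact (hglb.1 (by simp : v₁ ∈ _)).trans h₁.le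
      have := (grade_strictMono (𝕆 := ℕ)).monotone hcv
      exact ⟨(k + 1 - grade ℕ c, grade ℕ c), by simp; omega, c, rfl, hv, hc⟩
    · rintro ⟨_, -, c, -, hv, hc⟩
      exact ⟨hv, c, hc⟩
  rw [hunion, Finset.card_biUnion]
  · refine Finset.sum_congr rfl fun ij hij => ?_
    rw [Finset.card_biUnion]
    · rw [Finset.sum_congr rfl (g := fun _ => D.rootBifurcatedCount ij.1), Finset.sum_const,
        smul_eq_mul, mul_comm]
      intro c hc
      rw [← D.ncard_bifurcatedAt h hz hb c, ← Set.ncard_coe_finset]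
      congr 1
      ext v
      have := hmem.1 hc
      have := Finset.HasAntidiagonal.mem_antidiagonal.1 hij
      simp only [Finset.coe_filter, hmem, Set.mem_ofPred_eq]
      rw [show grade ℕ c + ij.1 = k + 1 by omega]
    · intro c _ c' _ hne
      refine Finset.disjoint_left.2 fun v hv hv' => hne ?_
      exact D.bifurcatedAt_unique hz hb (Finset.mem_filter.1 hv).2 (Finset.mem_filter.1 hv').2
  · intro ij hij ij' hij' hne
    refine Finset.disjoint_left.2 fun v hv hv' => hne ?_
    simp only [Finset.mem_biUnion, Finset.mem_filter, hmem] at hv hv'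
    obtain ⟨c, hc, -, hv⟩ := hv
    obtain ⟨c', hc', -, hv'⟩ := hv'
    obtain rfl := D.bifurcatedAt_unique hz hb hv hv'
    have := Finset.HasAntidiagonal.mem_antidiagonal.1 hij
    have := Finset.HasAntidiagonal.mem_antidiagonal.1 hij'
    ext <;> omega

end PlanarDiagram

end Upho

/-! ### Root-bifurcated vertices as joins of consecutive atoms. -/

section Upho

variable {P : Type*} [PartialOrder P] [GradeMinOrder ℕ P]

namespace PlanarDiagram

/-- A vertex at which the two outer subtrees over neighbouring atoms meet for the first time is the
least upper bound of two consecutive atoms. -/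
theorem exists_atoms_isLUB (D : PlanarDiagram P) (h : IsUpho P) {z : P} (hz : IsBot z) {b : ℕ}
    (hb : HasUpDegree P b) [NoMaxOrder P] {v : P} (hv : BifurcatedAt z v) :
    ∃ y y' : P, z ⋖ y ∧ z ⋖ y' ∧ D.xpos y < D.xpos y' ∧
      (∀ m, z ⋖ m → ¬ (D.xpos y < D.xpos m ∧ D.xpos m < D.xpos y')) ∧ IsLUB {y, y'} v := by
  obtain ⟨v₁, v₂, hne, h₁, h₂, hglb⟩ := hv
  wlog hx : D.xpos v₁ ≤ D.xpos v₂ generalizing v₁ v₂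
  · exact this v₂ v₁ hne.symm h₂ h₁ (Set.pair_comm v₁ v₂ ▸ hglb) (le_of_not_ge hx)
  have hadj := D.adjacent_of_covBy hz hb hne h₁ h₂
  have hg := hadj.2.1
  have hx : D.xpos v₁ < D.xpos v₂ := lt_of_le_of_ne hx fun h => hne (D.eq_of_xpos hg h)
  have hgv := grade_eq_add_one_of_covBy h₁
  have hmono := (grade_strictMono (𝕆 := ℕ) (α := P)).monotone
  have hz0 := grade_bot_eq_zero hz
  have hatom : ∀ {y}, z ⋖ y ↔ grade ℕ y = 1 := fun {y} =>
    ⟨fun hy => by rw [grade_eq_add_one_of_covBy hy, hz0],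
      fun hy => covBy_of_le_of_grade (hz y) (by omega)⟩
  have hside : ∀ {t}, grade ℕ t = grade ℕ v₁ → D.xpos t ≤ D.xpos v₁ ∨ D.xpos v₂ ≤ D.xpos t := by
    intro t ht
    have := (hadj.2.2 t ht).1
    grind
  have hpos : 1 ≤ grade ℕ v₁ := by
    by_contra! hlt
    exact hne ((eq_bot_of_grade_eq_zero hz (by omega)).trans
      (eq_bot_of_grade_eq_zero hz (by omega)).symm)
  have hdisj : ∀ {y}, grade ℕ y = 1 → y ≤ v₁ → y ≤ v₂ → False := by
    intro y hy hy1 hy2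
    have : y ≤ z := hglb.2 (by simp [lowerBounds, hy1, hy2])
    have := hmono this
    omega
  have hex : ∀ u : P, 1 ≤ grade ℕ u → ∃ y, y ≤ u ∧ grade ℕ y = 1 := fun u hu => by
    obtain ⟨y, -, hy, hy'⟩ := exists_between_of_grade (hz u) (r := 1) (by omega) hu
    exact ⟨y, hy, hy'⟩
  -- The two atoms are the rightmost one below `v₁` and the leftmost one below `v₂`. A path from an
  -- atom strictly between them would reach the rank of `v₁` left of `v₁` or right of `v₂`, and so
  -- would put that atom below `v₁` or `v₂`.
  obtain ⟨y, ⟨hyv, hy⟩, hymax⟩ := Set.exists_max_image {y | y ≤ v₁ ∧ grade ℕ y = 1} D.xpos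
    ((h.1 1).subset fun _ h => h.2) (hex v₁ hpos)
  obtain ⟨y', ⟨hyv', hy'⟩, hymin⟩ := Set.exists_min_image {y | y ≤ v₂ ∧ grade ℕ y = 1} D.xpos
    ((h.1 1).subset fun _ h => h.2) (hex v₂ (by omega))
  have hyy : D.xpos y < D.xpos y' := by
    by_contra! hle
    obtain ⟨w, hw1, -, hw3, hw4⟩ :=
      D.exists_common_of_crossing (hy'.trans hy.symm) hg.symm hyv' hyv hle hx.le
    exact hdisj hy' (hw1.trans hw4) (hw1.trans hw3)
  refine ⟨y, y', hatom.2 hy, hatom.2 hy', hyy, ?_, ?_, ?_⟩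
  · rintro m hm ⟨hm1, hm2⟩
    rw [hatom] at hm
    obtain ⟨t, hmt, ht⟩ := exists_le_of_grade m (hm.trans_le hpos)
    rcases hside ht with hs | hs
    · obtain ⟨w, -, hw, hwv, -⟩ :=
        D.exists_common_of_crossing (hy.trans hm.symm) ht.symm hyv hmt hm1.le hs
      exact hm1.not_ge (hymax m ⟨hw.trans hwv, hm⟩)
    · obtain ⟨w, hw, -, -, hwv⟩ :=
        D.exists_common_of_crossing (hm.trans hy'.symm) (ht.trans hg) hmt hyv' hm2.le hs
      exact hm2.not_ge (hymin m ⟨hw.trans hwv, hm⟩)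
  · simp [upperBounds, hyv.trans h₁.le, hyv'.trans h₂.le]
  intro w hw
  have hyw : y ≤ w := hw (by simp)
  have hyw' : y' ≤ w := hw (by simp)
  have hleft : ∀ {t}, grade ℕ t = grade ℕ v₁ → y ≤ t → D.xpos t ≤ D.xpos v₁ := by
    intro t ht hyt
    refine (hside ht).resolve_right fun hs => ?_
    obtain ⟨s, hs1, -, -, hs4⟩ :=
      D.exists_common_of_crossing (hy.trans hy'.symm) (ht.trans hg) hyt hyv' hyy.le hs
    exact hdisj hy hyv (hs1.trans hs4)
  have hright : ∀ {t}, grade ℕ t = grade ℕ v₁ → y' ≤ t → D.xpos v₂ ≤ D.xpos t := by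
    intro t ht hyt
    refine (hside ht).resolve_left fun hs => ?_
    obtain ⟨s, -, hs2, hs3, -⟩ :=
      D.exists_common_of_crossing (hy.trans hy'.symm) ht.symm hyv hyt hyy.le hs
    exact hdisj hy' (hs2.trans hs3) hyv'
  -- A low `w` would have a vertex above it both weakly left of `v₁` and weakly right of `v₂`. For a
  -- higher `w`, paths from `y` and `y'` to `w` pass on either side of `v`, which is therefore below
  -- `w`.
  rcases le_or_gt (grade ℕ w) (grade ℕ v₁) with hgw | hgw
  · obtain ⟨t, hwt, ht⟩ := exists_le_of_grade w hgw
    exact absurd ((hright ht (hyw'.trans hwt)).trans (hleft ht (hyw.trans hwt))) (not_le.2 hx)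
  obtain ⟨p, hyp, hpw, hp⟩ := exists_between_of_grade hyw (hy.trans_le hpos) hgw.le
  obtain ⟨p', hyp', hpw', hp'⟩ := exists_between_of_grade hyw' (hy'.trans_le hpos) hgw.le
  have hxp := hleft hp hyp
  have hxp' := hright hp' hyp'
  obtain ⟨q, hpq, hqw⟩ := exists_covBy_le (lt_of_le_of_ne hpw (by rintro rfl; omega))
  obtain ⟨q', hpq', hqw'⟩ := exists_covBy_le (lt_of_le_of_ne hpw' (by rintro rfl; omega))
  have gq := grade_eq_add_one_of_covBy hpq
  have gq' := grade_eq_add_one_of_covBy hpq'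
  exact D.le_of_xpos_between (by omega) (by omega)
    (D.xpos_le_of_covBy (by omega) (hxp.trans_lt hx) hpq h₂)
    (D.xpos_le_of_covBy (by omega) (hx.trans_le hxp') h₁ hpq') hqw hqw'

/-- Send each such vertex to the left atom of its pair. This atom determines the next one and hence
their join, so the map is injective; it misses the rightmost atom `M`. -/
theorem finite_rootBifurcated (D : PlanarDiagram P) (h : IsUpho P) {z : P} (hz : IsBot z) {b : ℕ}
    (hb : HasUpDegree P b) [NoMaxOrder P] :
    {v : P | D.RootBifurcated v}.Finite ∧ {v : P | D.RootBifurcated v}.ncard + 1 ≤ b := by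
  set A : Set P := {w | z ⋖ w} with hA
  have hAfin : A.Finite := Set.finite_of_encard_eq_coe (hb z)
  have hAcard : A.ncard = b := by rw [Set.ncard, hb z]; rfl
  have hgA : ∀ {y y'}, y ∈ A → y' ∈ A → grade ℕ y = grade ℕ y' := fun {y y'} hy hy' => by
    rw [grade_eq_add_one_of_covBy hy, grade_eq_add_one_of_covBy hy']
  have hAne : A.Nonempty := by
    obtain ⟨s, hs⟩ := exists_gt z
    obtain ⟨t, ht, -⟩ := exists_covBy_le hs
    exact ⟨t, ht⟩
  obtain ⟨M, hM, hmax⟩ := Set.exists_max_image A D.xpos hAfin hAne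
  have key : ∀ v : {v : P | D.RootBifurcated v}, _ := fun v =>
    D.exists_atoms_isLUB h hz hb ((D.rootBifurcated_iff hz hb).1 v.2)
  choose y y' hy hy' hyy hbetween hlub using key
  have hinj : Function.Injective y := by
    intro v w hvw
    have hnext : y' v = y' w := by
      refine D.eq_of_xpos (hgA (hy' v) (hy' w)) (le_antisymm ?_ ?_)
      · by_contra! hlt
        exact hbetween v _ (hy' w) ⟨hvw ▸ hyy w, hlt⟩
      · by_contra! hlt
        exact hbetween w _ (hy' v) ⟨hvw ▸ hyy v, hlt⟩
    have h1 := hlub v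
    rw [hvw, hnext] at h1
    exact Subtype.ext (h1.unique (hlub w))
  have hsub : Set.range y ⊆ A \ {M} := by
    rintro _ ⟨v, rfl⟩
    refine ⟨hy v, ?_⟩
    rintro (hvM : y v = M)
    exact (hvM ▸ hyy v).not_ge (hmax _ (hy' v))
  have hAM : (A \ {M}).Finite := hAfin.subset Set.sdiff_subset
  have hfin : Finite {v : P | D.RootBifurcated v} := by
    have := (hAM.subset hsub).to_subtype
    exact Finite.of_injective (fun v => (⟨y v, v, rfl⟩ : Set.range y))
      fun v w hvw => hinj (congrArg Subtype.val hvw)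
  refine ⟨hfin, ?_⟩
  have hle := Set.ncard_le_ncard hsub hAM
  rw [Set.ncard_range_of_injective hinj, Nat.card_coe_set_eq] at hle
  have := Set.ncard_sdiff_singleton_add_one hM hAfin
  omega

end PlanarDiagram

end Upho

/-! ### From the recurrence to the generating function. -/

theorem denomPoly_mul_eq_one (b n : ℕ) (a : ℕ → ℕ) (N : ℕ → ℕ) (h0 : N 0 = 1)
    (ha : ∀ i ∉ Finset.Icc 2 n, a i = 0)
    (hN : ∀ k, N (k + 1) + ∑ ij ∈ Finset.HasAntidiagonal.antidiagonal (k + 1), a ij.1 * N ij.2 =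
      b * N k) :
    (denomPoly b n a : PowerSeries ℤ) * PowerSeries.mk (fun k => (N k : ℤ)) = 1 := by
  have hQ : (denomPoly b n a : PowerSeries ℤ) =
      1 - PowerSeries.C (b : ℤ) * PowerSeries.X + PowerSeries.mk fun i => (a i : ℤ) := by
    ext k
    rw [Polynomial.coeff_coe, denomPoly]
    simp only [Polynomial.coeff_add, Polynomial.coeff_sub, map_add, map_sub,
      Polynomial.finsetSum_coeff, Polynomial.coeff_C_mul, Polynomial.coeff_X_pow,
      PowerSeries.coeff_mk, PowerSeries.coeff_C_mul, PowerSeries.coeff_X, Polynomial.coeff_X,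
      Polynomial.coeff_one, PowerSeries.coeff_one]
    congr 1
    · simp only [eq_comm]
    · simp only [mul_ite, mul_one, mul_zero, Finset.sum_ite_eq]
      split_ifs with hk
      · rfl
      · rw [ha k hk, Nat.cast_zero]
  have ha0 : a 0 = 0 := ha 0 (by simp)
  rw [hQ, add_mul, sub_mul, one_mul, mul_assoc]
  ext k
  rw [map_add, map_sub, PowerSeries.coeff_C_mul, PowerSeries.coeff_one]
  cases k with
  | zero => simp [h0, ha0]
  | succ k =>
    rw [PowerSeries.coeff_succ_X_mul, PowerSeries.coeff_mul]
    simp only [PowerSeries.coeff_mk]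
    have := hN k
    zify at this
    rw [if_neg (Nat.succ_ne_zero k)]
    linarith

theorem eval_one_denomPoly (b n : ℕ) (a : ℕ → ℕ) :
    (denomPoly b n a).eval 1 = 1 - (b : ℤ) + ∑ i ∈ Finset.Icc 2 n, (a i : ℤ) := by
  simp [denomPoly, Polynomial.eval_finsetSum]

theorem PlanarDiagram.exists_denomPoly {P : Type*} [PartialOrder P] [GradeMinOrder ℕ P] [Infinite P]
    (h : IsUpho P) (D : PlanarDiagram P) :
    ∃ b n : ℕ, HasUpDegree P b ∧
      (∀ i : ℕ, i ∉ Finset.Icc 2 n → D.rootBifurcatedCount i = 0) ∧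
      (denomPoly b n D.rootBifurcatedCount : PowerSeries ℤ) * rankGenFun P = 1 ∧
      (denomPoly b n D.rootBifurcatedCount).eval 1 ≤ 0 := by
  obtain ⟨z, hz⟩ := h.exists_isBot
  have := h.noMaxOrder
  have hb := h.hasUpDegree hz
  set b := {w : P | z ⋖ w}.ncard
  obtain ⟨hfin, hcard⟩ := D.finite_rootBifurcated h hz hb
  obtain ⟨n, hn⟩ : ∃ n, ∀ v, D.RootBifurcated v → grade ℕ v ≤ n := by
    obtain ⟨n, hn⟩ := (hfin.image (grade ℕ)).bddAbove
    exact ⟨n, fun v hv => hn ⟨v, hv, rfl⟩⟩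
  have hsupp : ∀ i : ℕ, i ∉ Finset.Icc 2 n → D.rootBifurcatedCount i = 0 := by
    intro i hi
    rcases Nat.lt_or_ge n i with hni | hni
    · have : {v : P | grade ℕ v = i ∧ D.RootBifurcated v} = ∅ := by
        ext v
        simp only [Set.mem_ofPred_eq, Set.mem_empty_iff_false, iff_false, not_and]
        intro hv hR
        have := hn v hR
        omega
      rw [rootBifurcatedCount, this, Set.ncard_empty]
    · have hi2 : i < 2 := by
        by_contra! h2
        exact hi (Finset.mem_Icc.2 ⟨h2, hni⟩)
      interval_cases i
      · exact D.rootBifurcatedCount_zero hz hb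
      · exact D.rootBifurcatedCount_one hz hb
  refine ⟨b, n, hb, hsupp, ?_, ?_⟩
  · refine denomPoly_mul_eq_one b n _ (fun k => {v : P | grade ℕ v = k}.ncard) ?_ hsupp
      (D.ncard_grade_succ h hz hb)
    have : {v : P | grade ℕ v = 0} = {z} := Set.eq_singleton_iff_unique_mem.2
      ⟨grade_bot_eq_zero hz, fun v hv => eq_bot_of_grade_eq_zero hz hv⟩
    simp only [this, Set.ncard_singleton]
  · have hsum : ∑ i ∈ Finset.Icc 2 n, D.rootBifurcatedCount i ≤
        {v : P | D.RootBifurcated v}.ncard := by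
      classical
      rw [Set.ncard_eq_toFinset_card _ hfin]
      have hle : ∀ i ∈ Finset.Icc 2 n, D.rootBifurcatedCount i =
          (hfin.toFinset.filter fun v => grade ℕ v = i).card := by
        intro i _
        rw [rootBifurcatedCount, ← Set.ncard_coe_finset]
        congr 1
        ext v
        simp [and_comm]
      rw [Finset.sum_congr rfl hle]
      rw [Finset.sum_card_fiberwise_eq_card_filter]
      exact Finset.card_filter_le _ _
    rw [eval_one_denomPoly]
    zify at hsum hcard
    linarith

/-! ### Construction of the gap word. -/

/-- The index at which the children of the `i`-th vertex of a row start in the next row, when every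
vertex has `c + 1` children and the last child of `j` is the first child of `j + 1` iff `g j = 1`. -/
def blockStart (c : ℕ) (g : ℕ → ℕ) (i : ℕ) : ℕ :=
  ∑ j ∈ Finset.range i, (c + if g j = 1 then 0 else 1)

theorem blockStart_succ (c : ℕ) (g : ℕ → ℕ) (i : ℕ) :
    blockStart c g (i + 1) = blockStart c g i + c + if g i = 1 then 0 else 1 := by
  rw [blockStart, Finset.sum_range_succ, ← blockStart, add_assoc]

theorem blockStart_monotone (c : ℕ) (g : ℕ → ℕ) : Monotone (blockStart c g) :=
  monotone_nat_of_le_succ fun i => by rw [blockStart_succ]; omega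

/-- Where children start depends only on the gaps passed over, so a stretch repeating a prefix of
the word reproduces its layout. -/
theorem blockStart_add {c : ℕ} {g : ℕ → ℕ} {s n : ℕ} (h : ∀ t < n, g (s + t) = g t) :
    ∀ t ≤ n, blockStart c g (s + t) = blockStart c g s + blockStart c g t := by
  intro t ht
  rw [blockStart, Finset.sum_range_add, ← blockStart, Nat.add_left_cancel_iff, blockStart]
  refine Finset.sum_congr rfl fun j hj => ?_
  rw [h j ((Finset.mem_range.1 hj).trans_le ht)]

/-- A word `gap` recording after how many rows the outer branches of consecutive vertices merge
(`0` standing for never). Inside the children of a vertex the gaps are `D 0, …, D (c - 1)`, and a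
gap between the children of two consecutive vertices is one less than the gap between these. -/
structure GapSystem (c : ℕ) (D : ℕ → ℕ) where
  /-- the gap between the vertices of index `i` and `i + 1` -/
  gap : ℕ → ℕ
  gap_inner : ∀ i t, t < c → gap (blockStart c gap i + t) = D t
  gap_outer : ∀ i, gap i ≠ 1 → gap (blockStart c gap i + c) = gap i - 1

/-- The recursive construction of the gap word. -/
def gapWord (c : ℕ) (D : ℕ → ℕ) (m : ℕ) : ℕ :=
  -- Cutting off at `m` makes the recursion well-founded; the value `0` is harmless since the starts
  -- of the blocks up to `m` use only gaps before `m`. Then `i` is the block containing `m`.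
  let h : ℕ → ℕ := fun j => if _ : j < m then gapWord c D j else 0
  let i := Nat.findGreatest (fun i => blockStart c h i ≤ m) m
  if m - blockStart c h i < c then D (m - blockStart c h i) else h i - 1
termination_by m

theorem gapWord_eq {c : ℕ} {D : ℕ → ℕ} {m i : ℕ} (him : i ≤ m)
    (h₁ : blockStart c (gapWord c D) i ≤ m) (h₂ : m < blockStart c (gapWord c D) (i + 1)) :
    gapWord c D m = if m - blockStart c (gapWord c D) i < c then
      D (m - blockStart c (gapWord c D) i) else (if i < m then gapWord c D i else 0) - 1 := by
  have hstart : ∀ k ≤ m, blockStart c (fun j => if j < m then gapWord c D j else 0) k =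
      blockStart c (gapWord c D) k := by
    intro k hk
    refine Finset.sum_congr rfl fun j hj => ?_
    simp only [if_pos ((Finset.mem_range.1 hj).trans_le hk)]
  have hgreatest : Nat.findGreatest
      (fun i => blockStart c (fun j => if j < m then gapWord c D j else 0) i ≤ m) m = i := by
    rw [Nat.findGreatest_eq_iff]
    refine ⟨him, fun _ => (hstart i him).trans_le h₁, fun k hik hkm => ?_⟩
    rw [hstart k hkm, not_le]
    exact h₂.trans_le (blockStart_monotone c _ hik)
  rw [gapWord]
  simp only [dite_eq_ite]
  rw [hgreatest, hstart i him]

theorem le_blockStart {c : ℕ} (hc : 0 < c) (g : ℕ → ℕ) (i : ℕ) : i ≤ blockStart c g i := by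
  induction i with
  | zero => exact Nat.zero_le _
  | succ i ih => rw [blockStart_succ]; omega

theorem GapSystem.nonempty (c : ℕ) (D : ℕ → ℕ) : Nonempty (GapSystem c D) := by
  rcases Nat.eq_zero_or_pos c with rfl | hc
  -- With one child per vertex there are no inner gaps, and the outer condition reads `0 = 0 - 1`,
  -- true by truncated subtraction.
  · exact ⟨⟨fun _ => 0, fun _ _ h => absurd h (Nat.not_lt_zero _), fun _ _ => rfl⟩⟩
  refine ⟨⟨gapWord c D, fun i t ht => ?_, fun i hi => ?_⟩⟩
  · have := le_blockStart hc (gapWord c D) i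
    rw [gapWord_eq (i := i) (by omega) (by omega) (by rw [blockStart_succ]; omega),
      Nat.add_sub_cancel_left, if_pos ht]
  · have := le_blockStart hc (gapWord c D) i
    rw [gapWord_eq (i := i) (by omega) (by omega) (by rw [blockStart_succ, if_neg hi]; omega),
      Nat.add_sub_cancel_left, if_neg (lt_irrefl c), if_pos (by omega)]

/-! ### Self-similarity of the gap word. -/

namespace GapSystem

variable {c : ℕ} {D : ℕ → ℕ} (S : GapSystem c D)

/-- The index of the first child. -/
def fst (i : ℕ) : ℕ := blockStart c S.gap i

/-- The index of the last child. -/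
def lst (i : ℕ) : ℕ := S.fst i + c

theorem fst_zero : S.fst 0 = 0 := rfl

theorem fst_monotone : Monotone S.fst := blockStart_monotone c S.gap

theorem lst_monotone : Monotone S.lst := fun _ _ h => Nat.add_le_add_right (S.fst_monotone h) c

theorem fst_succ (i : ℕ) : S.fst (i + 1) = S.fst i + c + if S.gap i = 1 then 0 else 1 :=
  blockStart_succ c S.gap i

theorem iterate_fst_zero (m : ℕ) : S.fst^[m] 0 = 0 := Function.iterate_fixed S.fst_zero m

theorem iterate_fst_le_iterate_lst (m i : ℕ) : S.fst^[m] i ≤ S.lst^[m] i :=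
  S.fst_monotone.iterate_le_of_le (fun _ => Nat.le_add_right _ _) m i

/-- The intervals of children of consecutive vertices overlap or abut, so together they leave no
index out. -/
theorem exists_parent {i j t : ℕ} (hij : i ≤ j) (h₁ : S.fst i ≤ t) (h₂ : t ≤ S.lst j) :
    ∃ s, i ≤ s ∧ s ≤ j ∧ S.fst s ≤ t ∧ t ≤ S.lst s := by
  induction j, hij using Nat.le_induction with
  | base => exact ⟨i, le_rfl, le_rfl, h₁, h₂⟩
  | succ j hij ih =>
    rcases le_or_gt (S.fst (j + 1)) t with h | h
    · exact ⟨j + 1, by omega, le_rfl, h, h₂⟩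
    · have := S.fst_succ j
      obtain ⟨s, h1, h2, h3⟩ := ih (by rw [lst]; split_ifs at this <;> omega)
      exact ⟨s, h1, by omega, h3⟩

theorem exists_block {n t : ℕ} (h : t < S.lst n) :
    (∃ s ≤ n, ∃ r < c, t = S.fst s + r) ∨ ∃ s < n, S.gap s ≠ 1 ∧ t = S.fst s + c := by
  induction n with
  | zero => exact Or.inl ⟨0, le_rfl, t, by simpa [lst, fst_zero] using h, by simp [fst_zero]⟩
  | succ n ih =>
    rw [lst] at h
    rcases le_or_gt (S.fst (n + 1)) t with h1 | h1
    · exact Or.inl ⟨n + 1, le_rfl, t - S.fst (n + 1), by omega, by omega⟩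
    rcases lt_or_ge t (S.lst n) with h2 | h2
    · rcases ih h2 with ⟨s, hs, H⟩ | ⟨s, hs, H⟩
      · exact Or.inl ⟨s, by omega, H⟩
      · exact Or.inr ⟨s, by omega, H⟩
    · rw [lst] at h2
      rw [fst_succ] at h1
      exact Or.inr ⟨n, by omega, by split_ifs at h1 with h3 <;> omega,
        by split_ifs at h1 <;> omega⟩

/-- The descendants of `i` after `m` rows form an interval as long as row `m`, with the same gaps.
The two claims are proved together: equal gaps give equal layout one row further (`blockStart_add`),
where each gap is inner or inherited from an equal gap. -/
theorem lst_iterate_eq_and_gap_eq (m i : ℕ) :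
    S.lst^[m] i = S.fst^[m] i + S.lst^[m] 0 ∧
      ∀ t < S.lst^[m] 0, S.gap (S.fst^[m] i + t) = S.gap t := by
  induction m with
  | zero => simp
  | succ m ih =>
    obtain ⟨ih1, ih2⟩ := ih
    simp only [Function.iterate_succ_apply']
    set A := S.fst^[m] i
    set n := S.lst^[m] 0
    have hadd : ∀ t ≤ n, S.fst (A + t) = S.fst A + S.fst t := blockStart_add ih2
    refine ⟨by rw [ih1, lst, lst, hadd n le_rfl, add_assoc], fun t ht => ?_⟩
    rcases S.exists_block ht with ⟨s, hs, r, hr, rfl⟩ | ⟨s, hs, hgap, rfl⟩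
    · rw [← add_assoc, ← hadd s hs]
      exact (S.gap_inner _ _ hr).trans (S.gap_inner _ _ hr).symm
    · rw [← add_assoc, ← hadd s hs.le]
      refine (S.gap_outer _ ?_).trans (Eq.trans ?_ (S.gap_outer _ hgap).symm) <;> rw [ih2 s hs]
      exact hgap

theorem fst_iterate_add {m i t : ℕ} (ht : t ≤ S.lst^[m] 0) (l : ℕ) :
    S.fst^[l] (S.fst^[m] i + t) = S.fst^[m + l] i + S.fst^[l] t := by
  induction l with
  | zero => rfl
  | succ l ih =>
    rw [Function.iterate_succ_apply', ih, ← add_assoc m, Function.iterate_succ_apply',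
      Function.iterate_succ_apply']
    refine blockStart_add (S.lst_iterate_eq_and_gap_eq (m + l) i).2 _ ?_
    rw [add_comm m, Function.iterate_add_apply]
    exact (S.iterate_fst_le_iterate_lst l t).trans (S.lst_monotone.iterate l ht)

theorem lst_iterate_add {m i t : ℕ} (ht : t ≤ S.lst^[m] 0) (l : ℕ) :
    S.lst^[l] (S.fst^[m] i + t) = S.fst^[m + l] i + S.lst^[l] t := by
  rw [(S.lst_iterate_eq_and_gap_eq l _).1, S.fst_iterate_add ht,
    (S.lst_iterate_eq_and_gap_eq l t).1, add_assoc]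

/-! ### The poset of a gap word and its diagram. -/

/-- A vertex, given by its rank and its index among the vertices of that rank. -/
@[ext]
structure Vertex where
  /-- the rank -/
  rank : ℕ
  /-- the index in the row -/
  idx : ℕ
  idx_le : idx ≤ S.lst^[rank] 0

variable {S}

instance : PartialOrder S.Vertex where
  le v w := ∃ m, w.rank = v.rank + m ∧ S.fst^[m] v.idx ≤ w.idx ∧ w.idx ≤ S.lst^[m] v.idx
  le_refl v := ⟨0, rfl, le_rfl, le_rfl⟩
  le_trans := by
    rintro u v w ⟨m, h1, h2, h3⟩ ⟨l, h1', h2', h3'⟩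
    refine ⟨l + m, by omega, ?_, ?_⟩ <;> rw [Function.iterate_add_apply]
    · exact (S.fst_monotone.iterate l h2).trans h2'
    · exact h3'.trans (S.lst_monotone.iterate l h3)
  le_antisymm := by
    rintro u v ⟨m, h1, h2, h3⟩ ⟨l, h1', h2', h3'⟩
    obtain rfl : m = 0 := by omega
    exact Vertex.ext h1.symm (le_antisymm h2 h3)

theorem Vertex.le_iff {v w : S.Vertex} :
    v ≤ w ↔ ∃ m, w.rank = v.rank + m ∧ S.fst^[m] v.idx ≤ w.idx ∧ w.idx ≤ S.lst^[m] v.idx := Iff.rfl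

theorem Vertex.rank_lt {v w : S.Vertex} (h : v < w) : v.rank < w.rank := by
  obtain ⟨m, h1, h2, h3⟩ := h.le
  rcases Nat.eq_zero_or_pos m with rfl | hm
  · exact absurd (Vertex.ext h1.symm (le_antisymm h2 h3)) h.ne
  · omega

theorem Vertex.covBy_iff {v w : S.Vertex} :
    v ⋖ w ↔ w.rank = v.rank + 1 ∧ S.fst v.idx ≤ w.idx ∧ w.idx ≤ S.lst v.idx := by
  constructor
  · intro h
    have hlt := Vertex.rank_lt h.lt
    obtain ⟨m, h1, h2, h3⟩ := h.le
    obtain ⟨m, rfl⟩ : ∃ l, m = l + 1 := ⟨m - 1, by omega⟩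
    rcases Nat.eq_zero_or_pos m with rfl | hm
    · exact ⟨h1, h2, h3⟩
    rw [Function.iterate_succ_apply'] at h2 h3
    -- If `w` lies two or more rows above `v`, a parent of `w` among the descendants of `v`
    -- separates them.
    obtain ⟨s, hs1, hs2, hs3, hs4⟩ :=
      S.exists_parent (S.iterate_fst_le_iterate_lst m v.idx) h2 h3
    let u : S.Vertex := ⟨v.rank + m, s, by
      rw [add_comm, Function.iterate_add_apply]
      exact hs2.trans (S.lst_monotone.iterate m v.idx_le)⟩
    have hvu : v ≤ u := ⟨m, rfl, hs1, hs2⟩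
    have huw : u ≤ w := ⟨1, h1, hs3, hs4⟩
    refine absurd (lt_of_le_of_ne huw fun e => ?_) (h.2 (lt_of_le_of_ne hvu fun e => ?_))
    · have : v.rank + m = w.rank := congrArg (fun x : S.Vertex => x.rank) e
      omega
    · have : v.rank = v.rank + m := congrArg (fun x : S.Vertex => x.rank) e
      omega
  · rintro ⟨h1, h2, h3⟩
    refine ⟨lt_of_le_of_ne ⟨1, h1, h2, h3⟩ (by rintro rfl; omega), fun u hvu huw => ?_⟩
    have := Vertex.rank_lt hvu
    have := Vertex.rank_lt huw
    omega

instance : GradeMinOrder ℕ S.Vertex where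
  grade v := v.rank
  grade_strictMono _ _ h := Vertex.rank_lt h
  covBy_grade _ _ h := Nat.covBy_iff_add_one_eq.2 (Vertex.covBy_iff.1 h).1.symm
  isMin_grade v h := by
    let z : S.Vertex := ⟨0, 0, le_rfl⟩
    have hz : z ≤ v := ⟨v.rank, (zero_add _).symm, (S.iterate_fst_zero _).trans_le (Nat.zero_le _),
      v.idx_le⟩
    obtain rfl := le_antisymm hz (h hz)
    exact isMin_bot

theorem Vertex.grade_eq (v : S.Vertex) : grade ℕ v = v.rank := rfl

instance : Infinite S.Vertex :=
  Infinite.of_injective (fun k : ℕ => (⟨k, 0, Nat.zero_le _⟩ : S.Vertex))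
    fun _ _ h => congrArg (fun x : S.Vertex => x.rank) h

theorem Vertex.injOn_index (k : ℕ) :
    Set.InjOn (fun v : S.Vertex => v.idx) {v | grade ℕ v = k} := fun _ hv _ hw h =>
  Vertex.ext (Eq.trans hv (Eq.symm hw)) h

theorem Vertex.image_index_grade (k : ℕ) :
    (fun v : S.Vertex => v.idx) '' {v | grade ℕ v = k} = Finset.Iic (S.lst^[k] 0) := by
  ext i
  simp only [Set.mem_image, Set.mem_ofPred_eq, Finset.coe_Iic, Set.mem_Iic]
  constructor
  · rintro ⟨v, rfl, rfl⟩
    exact v.idx_le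
  · intro hi
    exact ⟨⟨k, i, hi⟩, rfl, rfl⟩

theorem Vertex.finite_grade (k : ℕ) : {v : S.Vertex | grade ℕ v = k}.Finite :=
  Set.Finite.of_finite_image (Vertex.image_index_grade k ▸ Finset.finite_toSet _)
    (Vertex.injOn_index k)

theorem Vertex.ncard_grade (k : ℕ) :
    {v : S.Vertex | grade ℕ v = k}.ncard = S.lst^[k] 0 + 1 := by
  rw [← (Vertex.injOn_index k).ncard_image, Vertex.image_index_grade,
    Set.ncard_coe_finset, Nat.card_Iic]

/-- The self-similarity map onto the principal filter of `s`. -/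
def Vertex.shift (s : S.Vertex) : S.Vertex ↪o S.Vertex :=
  OrderEmbedding.ofMapLEIff (fun v => ⟨s.rank + v.rank, S.fst^[v.rank] s.idx + v.idx, by
    rw [add_comm s.rank, Function.iterate_add_apply]
    refine le_trans ?_ (S.lst_monotone.iterate v.rank s.idx_le)
    rw [(S.lst_iterate_eq_and_gap_eq v.rank s.idx).1]
    exact Nat.add_le_add_left v.idx_le _⟩) fun v w => by
    simp only [Vertex.le_iff]
    refine exists_congr fun l => ?_
    rw [S.fst_iterate_add v.idx_le, S.lst_iterate_add v.idx_le]
    rw [add_assoc, Nat.add_left_cancel_iff]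
    refine and_congr_right fun h => ?_
    rw [h, Nat.add_le_add_iff_left, Nat.add_le_add_iff_left]

theorem Vertex.range_shift (s : S.Vertex) : Set.range s.shift = Set.Ici s := by
  ext w
  constructor
  · rintro ⟨v, rfl⟩
    refine ⟨v.rank, rfl, Nat.le_add_right _ _, ?_⟩
    rw [(S.lst_iterate_eq_and_gap_eq v.rank s.idx).1]
    exact Nat.add_le_add_left v.idx_le _
  · rintro ⟨m, h1, h2, h3⟩
    rw [(S.lst_iterate_eq_and_gap_eq m s.idx).1] at h3
    refine ⟨⟨m, w.idx - S.fst^[m] s.idx, by omega⟩, ?_⟩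
    exact Vertex.ext h1.symm (Nat.add_sub_cancel' h2)

theorem isUpho_vertex : IsUpho S.Vertex :=
  ⟨Vertex.finite_grade, fun s =>
    ⟨(OrderIso.setCongr _ _ s.range_shift.symm).trans s.shift.orderIso.symm⟩⟩

theorem hasUpDegree_vertex : HasUpDegree S.Vertex (c + 1) := by
  intro v
  have hinj : Set.InjOn (fun w : S.Vertex => w.idx) {w | v ⋖ w} :=
    (Vertex.injOn_index (v.rank + 1)).mono fun w hw => (Vertex.covBy_iff.1 hw).1
  have himage : (fun w : S.Vertex => w.idx) '' {w | v ⋖ w} =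
      Finset.Icc (S.fst v.idx) (S.lst v.idx) := by
    ext j
    simp only [Set.mem_image, Set.mem_ofPred_eq, Finset.coe_Icc, Set.mem_Icc, Vertex.covBy_iff]
    constructor
    · rintro ⟨w, hw, rfl⟩
      exact hw.2
    · intro hj
      refine ⟨⟨v.rank + 1, j, ?_⟩, ⟨rfl, hj⟩, rfl⟩
      rw [Function.iterate_succ_apply']
      exact hj.2.trans (S.lst_monotone v.idx_le)
  rw [← hinj.encard_image, himage, Set.encard_coe_eq_coe_finsetCard, Nat.card_Icc, lst]
  congr 1
  omega

/-- The diagram drawing the vertex `(k, i)` at the point `(i, k)`. -/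
def planarDiagram (S : GapSystem c D) : PlanarDiagram S.Vertex where
  xpos v := v.idx
  point_injective v w h := by
    simp only [Prod.mk.injEq, Nat.cast_inj] at h
    exact Vertex.ext h.2 h.1
  edges_disjoint := by
    have key : ∀ u v u' v' : S.Vertex, u ⋖ v → u' ⋖ v' → u.idx < u'.idx → v.idx ≤ v'.idx := by
      intro u v u' v' h h' hlt
      have h1 : v.idx ≤ S.fst u.idx + c := (Vertex.covBy_iff.1 h).2.2
      have h2 := (Vertex.covBy_iff.1 h').2.1
      have h3 : S.fst (u.idx + 1) ≤ S.fst u'.idx := S.fst_monotone hlt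
      have h4 := S.fst_succ u.idx
      omega
    intro u v u' v' h h' hne
    have hv := (Vertex.covBy_iff.1 h).1
    have hv' := (Vertex.covBy_iff.1 h').1
    rw [openSegment_eq_image, openSegment_eq_image, Set.disjoint_left]
    rintro _ ⟨θ, ⟨hθ0, hθ1⟩, rfl⟩ ⟨η, ⟨hη0, hη1⟩, he⟩
    simp only [Vertex.grade_eq, hv, hv', Prod.smul_mk, smul_eq_mul, Prod.mk_add_mk,
      Prod.mk.injEq, Nat.cast_add, Nat.cast_one] at he
    obtain ⟨hx, hy⟩ := he
    have hy : (u'.rank : ℝ) + η = u.rank + θ := by linarith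
    -- Equal heights with both parameters strictly between `0` and `1` force equal ranks, and then
    -- equal parameters.
    have hr : u'.rank = u.rank := by
      have h1 : (u'.rank : ℝ) < u.rank + 1 := by linarith
      have h2 : (u.rank : ℝ) < u'.rank + 1 := by linarith
      norm_cast at h1 h2
      omega
    obtain rfl : η = θ := by rw [hr] at hy; linarith
    rcases lt_trichotomy u.idx u'.idx with hlt | heq | hlt
    · have hle := key u v u' v' h h' hlt
      have hlt : (u.idx : ℝ) < u'.idx := by exact_mod_cast hlt
      have hle : (v.idx : ℝ) ≤ v'.idx := by exact_mod_cast hle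
      nlinarith
    · rw [heq] at hx
      have hvx : (v'.idx : ℝ) = v.idx := mul_left_cancel₀ hη0.ne' (by linarith)
      refine hne (Prod.ext (Vertex.ext hr.symm heq) (Vertex.ext ?_ ?_))
      · exact hv.trans (hr ▸ hv'.symm)
      · exact_mod_cast hvx.symm
    · have hle := key u' v' u v h' h hlt
      have hlt : (u'.idx : ℝ) < u.idx := by exact_mod_cast hlt
      have hle : (v'.idx : ℝ) ≤ v.idx := by exact_mod_cast hle
      nlinarith

/-! ### Counting gaps and vertices by rows. -/

/-- The number of gaps equal to `r` among the first `n`. -/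
def gapCount (S : GapSystem c D) (n r : ℕ) : ℕ :=
  ∑ i ∈ Finset.range n, if S.gap i = r then 1 else 0

theorem fst_add_gapCount (S : GapSystem c D) (n : ℕ) :
    S.fst n + S.gapCount n 1 = (c + 1) * n := by
  induction n with
  | zero => rfl
  | succ n ih =>
    rw [fst_succ, gapCount, Finset.sum_range_succ, ← gapCount, mul_add, ← ih]
    split_ifs <;> ring

/-- Each of the `n + 1` vertices creates its inner gaps, and each gap `r + 1` between two of them
becomes `r`. The bound `1 ≤ r` matters: a gap `0` stays `0`, and a gap `1` disappears. -/
theorem gapCount_lst (S : GapSystem c D) {r : ℕ} (hr : 1 ≤ r) (n : ℕ) :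
    S.gapCount (S.lst n) r =
      (n + 1) * (∑ t ∈ Finset.range c, if D t = r then 1 else 0) + S.gapCount n (r + 1) := by
  have hlst : ∀ n, S.gapCount (S.lst n) r =
      S.gapCount (S.fst n) r + ∑ t ∈ Finset.range c, if D t = r then 1 else 0 := by
    intro n
    rw [gapCount, lst, Finset.sum_range_add, gapCount, Nat.add_left_cancel_iff]
    refine Finset.sum_congr rfl fun t ht => ?_
    rw [fst, S.gap_inner n t (Finset.mem_range.1 ht)]
  induction n with
  | zero => rw [hlst, fst_zero, zero_add, one_mul, add_comm]; rfl
  | succ n ih =>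
    have hstep : S.gapCount (S.fst (n + 1)) r =
        S.gapCount (S.lst n) r + if S.gap n = r + 1 then 1 else 0 := by
      rw [fst_succ]
      by_cases h : S.gap n = 1
      · rw [if_pos h, if_neg (by omega), add_zero, add_zero, lst]
      · rw [if_neg h, gapCount, Finset.sum_range_succ, ← gapCount, lst, fst, S.gap_outer n h]
        congr 1
        have : S.gap n - 1 = r ↔ S.gap n = r + 1 := by omega
        simp only [this]
    rw [hlst, hstep, ih, gapCount, gapCount, Finset.sum_range_succ]
    ring

/-- A gap `r` in row `k` arose among the children of a vertex in some row `j`, with size `r + (k - 1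
- j)`, and has since shrunk by one per row. -/
theorem gapCount_row (S : GapSystem c D) (k : ℕ) {r : ℕ} (hr : 1 ≤ r) :
    S.gapCount (S.lst^[k] 0) r = ∑ j ∈ Finset.range k,
      (∑ t ∈ Finset.range c, if D t = r + (k - 1 - j) then 1 else 0) * (S.lst^[j] 0 + 1) := by
  induction k generalizing r with
  | zero => rfl
  | succ k ih =>
    rw [Function.iterate_succ_apply', S.gapCount_lst hr, ih (by omega), Finset.sum_range_succ,
      add_comm, mul_comm (S.lst^[k] 0 + 1)]
    congr 1
    · refine Finset.sum_congr rfl fun j hj => ?_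
      have := Finset.mem_range.1 hj
      rw [show r + 1 + (k - 1 - j) = r + (k + 1 - 1 - j) by omega]
    · rw [show r + (k + 1 - 1 - k) = r by omega]

/-- Row `k + 1` has `c + 1` vertices for each one of row `k`, less one for each gap `1` there. By
`gapCount_row`, such gaps originating in row `j` number `a (k + 1 - j)` times the size of that row.
-/
theorem rowCard_succ (S : GapSystem c D) {a : ℕ → ℕ} (ha0 : a 0 = 0) (ha1 : a 1 = 0)
    (hD : ∀ r, 1 ≤ r → (∑ t ∈ Finset.range c, if D t = r then 1 else 0) = a (r + 1)) (k : ℕ) :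
    S.lst^[k + 1] 0 + 1 + ∑ ij ∈ Finset.HasAntidiagonal.antidiagonal (k + 1),
      a ij.1 * (S.lst^[ij.2] 0 + 1) = (c + 1) * (S.lst^[k] 0 + 1) := by
  rw [← Finset.Nat.sum_antidiagonal_swap, Finset.Nat.sum_antidiagonal_eq_sum_range_succ_mk,
    Finset.sum_range_succ, Finset.sum_range_succ]
  simp only [Prod.swap_prod_mk, Nat.sub_self, Nat.add_sub_cancel_left, ha0, ha1, zero_mul, add_zero]
  have hcount := S.gapCount_row k le_rfl
  have hrow := S.fst_add_gapCount (S.lst^[k] 0)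
  rw [hcount] at hrow
  rw [Function.iterate_succ_apply', lst, mul_add, ← hrow]
  have : ∀ j ∈ Finset.range k, a (k + 1 - j) * (S.lst^[j] 0 + 1) =
      (∑ t ∈ Finset.range c, if D t = 1 + (k - 1 - j) then 1 else 0) * (S.lst^[j] 0 + 1) := by
    intro j hj
    have := Finset.mem_range.1 hj
    rw [hD _ (by omega), show 1 + (k - 1 - j) + 1 = k + 1 - j by omega]
  rw [Finset.sum_congr rfl this]
  ring

end GapSystem

/-! ### Realizing prescribed coefficients. -/

theorem sum_getD_eq_count (L : List ℕ) {r : ℕ} (hr : r ≠ 0) :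
    ∀ {c : ℕ}, L.length ≤ c →
      (∑ t ∈ Finset.range c, if L.getD t 0 = r then 1 else 0) = L.count r := by
  induction L with
  | nil => intro c _; simp [hr.symm]
  | cons x L ih =>
    intro c hc
    rw [List.length_cons] at hc
    obtain ⟨c, rfl⟩ : ∃ d, c = d + 1 := ⟨c - 1, by omega⟩
    rw [Finset.sum_range_succ', List.count_cons]
    simp only [List.getD_cons_succ, List.getD_cons_zero, beq_iff_eq]
    rw [ih (by omega)]

theorem exists_sequence_with_counts (f : ℕ → ℕ) (s : Finset ℕ) {c : ℕ} (hc : ∑ r ∈ s, f r ≤ c) :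
    ∃ D : ℕ → ℕ, ∀ r, 1 ≤ r →
      (∑ t ∈ Finset.range c, if D t = r then 1 else 0) = if r ∈ s then f r else 0 := by
  set M : Multiset ℕ := ∑ r ∈ s, Multiset.replicate (f r) r with hM
  -- Unused positions are padded with `0`, the gap that never closes, which no count with `1 ≤ r`
  -- sees.
  refine ⟨fun t => M.toList.getD t 0, fun r hr => ?_⟩
  rw [sum_getD_eq_count _ (by omega), ← Multiset.coe_count, Multiset.coe_toList, hM,
    Multiset.count_sum']
  · simp [Multiset.count_replicate]
  · rw [Multiset.length_toList, hM, Multiset.card_sum]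
    simpa using hc

theorem exists_planar_upho (b n : ℕ) (a : ℕ → ℕ) (h : (denomPoly b n a).eval 1 ≤ 0) :
    ∃ (P : Type) (_ : PartialOrder P) (_ : GradeMinOrder ℕ P),
      Infinite P ∧ IsUpho P ∧ Nonempty (PlanarDiagram P) ∧ HasUpDegree P b ∧
      (denomPoly b n a : PowerSeries ℤ) * rankGenFun P = 1 := by
  rw [eval_one_denomPoly] at h
  have hsum : ∑ i ∈ Finset.Icc 2 n, a i + 1 ≤ b := by
    zify
    linarith
  obtain ⟨c, rfl⟩ : ∃ c, b = c + 1 := ⟨b - 1, by omega⟩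
  -- Values of `a` outside `2, …, n` are arbitrary and do not enter the polynomial, so they are set
  -- to zero for the recurrence.
  set a' : ℕ → ℕ := fun i => if i ∈ Finset.Icc 2 n then a i else 0 with ha'
  have hpoly : denomPoly (c + 1) n a = denomPoly (c + 1) n a' := by
    rw [denomPoly, denomPoly]
    congr 1
    refine Finset.sum_congr rfl fun i hi => ?_
    simp only [ha', if_pos hi]
  -- The index shifts by one because atoms have rank `1`: neighbouring atoms with gap `r` first
  -- share a vertex in rank `r + 1`.
  obtain ⟨D, hD⟩ := exists_sequence_with_counts (fun r => a (r + 1)) (Finset.Icc 1 (n - 1))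
    (c := c) (by
    refine le_trans (le_of_eq ?_) (Nat.le_of_succ_le_succ hsum)
    refine Finset.sum_bij (fun r _ => r + 1) ?_ ?_ ?_ ?_
    · intro r hr
      simp only [Finset.mem_Icc] at hr ⊢
      omega
    · intro r _ s _ hrs
      omega
    · intro i hi
      simp only [Finset.mem_Icc] at hi
      exact ⟨i - 1, by simp only [Finset.mem_Icc]; omega, by omega⟩
    · intro r _
      rfl)
  have hD' : ∀ r, 1 ≤ r → (∑ t ∈ Finset.range c, if D t = r then 1 else 0) = a' (r + 1) := by
    intro r hr
    rw [hD r hr, ha']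
    refine if_congr ?_ rfl rfl
    simp only [Finset.mem_Icc]
    omega
  obtain ⟨S⟩ := GapSystem.nonempty c D
  refine ⟨S.Vertex, inferInstance, inferInstance, inferInstance, GapSystem.isUpho_vertex,
    ⟨S.planarDiagram⟩, GapSystem.hasUpDegree_vertex, ?_⟩
  rw [hpoly, rankGenFun]
  simp only [GapSystem.Vertex.ncard_grade]
  exact denomPoly_mul_eq_one (c + 1) n a' (fun k => S.lst^[k] 0 + 1) rfl
    (fun i hi => by simp only [ha', if_neg hi])
    (S.rowCard_succ (by simp [ha']) (by simp [ha']) hD')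

theorem theorem1p3 :
    (∀ (P : Type*) [PartialOrder P] [GradeMinOrder ℕ P] [Infinite P], IsUpho P →
      ∀ D : PlanarDiagram P, ∃ b n : ℕ,
        HasUpDegree P b ∧
        (∀ i : ℕ, i ∉ Finset.Icc 2 n → D.rootBifurcatedCount i = 0) ∧
        (denomPoly b n D.rootBifurcatedCount : PowerSeries ℤ) * rankGenFun P = 1 ∧
        (denomPoly b n D.rootBifurcatedCount).eval 1 ≤ 0) ∧
    (∀ (b n : ℕ) (a : ℕ → ℕ), (denomPoly b n a).eval 1 ≤ 0 →
      ∃ (P : Type) (_ : PartialOrder P) (_ : GradeMinOrder ℕ P),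
        Infinite P ∧ IsUpho P ∧ Nonempty (PlanarDiagram P) ∧ HasUpDegree P b ∧
        (denomPoly b n a : PowerSeries ℤ) * rankGenFun P = 1) := by
  exact ⟨fun P _ _ _ h D => D.exists_denomPoly h, exists_planar_upho⟩
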